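/- **Setting.** Tasks $k=1,\dots,t$ ($t\ge 1$, task $t$ being the current one) have data distributions $\mathfrak D_k$ on pairs $(x,y)$ and forgetting tolerances $\epsilon_k\in\mathbb R$. Let $\mathcal F$ be a set of square-integrable predictors with the $L_2$ norm, $\ell$ a loss such that $\ell(f(x),y)$ is $\mathfrak D_k$-integrable for all $f\in\mathcal F$ and all $k$, and $\{f_\theta:\theta\in\Theta\}\subseteq\mathcal F$ a parameterization. Put $L_k(f)=\mathbb E_{\mathfrak D_k}[\ell(f(x),y)]$ and, for a sample of size $n_k$ from task $k$, $\hat L_k(f)=\frac1{n_k}\sum_{i=1}^{n_k}\ell(f(x_i),y_i)$. The Lagrangian is $\mathcal L(f,\lambda)=L_t(f)+\sum_{k=1}^t\lambda_k(L_k(f)-\epsilon_k)$, and $\hat{\mathcal L}$ is the same with $\hat L_k$ in place of $L_k$. For $\lambda\in\mathbb R^t_+$ let $g_u(\lambda)=\inf_{f\in\mathcal F}\mathcal L(f,\lambda)$, $g_p(\lambda)=\inf_{\theta}\mathcal L(f_\theta,\lambda)$, $\hat g_p(\lambda)=\inf_{\theta}\hat{\mathcal L}(f_\theta,\lambda)$.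 **Assumptions.** (i) $\mathcal F$ is convex, $f\mapsto\ell(f(x),y)$ is convex on $\mathcal F$ for all $(x,y)$, and some $f\in\mathcal F$ has $L_k(f)<\epsilon_k$ for all $k$. (ii) For every $f\in\mathcal F$ there is $\theta\in\Theta$ with $\|f-f_\theta\|_{L_2}\le\nu$, where $\nu>0$. (iii) There are $R>0$ and $M\ge 0$ such that $\|f\|_{L_2}\le R$ for all $f\in\mathcal F$, and the loss is $M$-Lipschitz in $f$ in the sense that $\mathbb E_{\mathfrak D_k}|\ell(f(x),y)-\ell(g(x),y)|\le M\|f-g\|_{L_2}$ for all $f,g\in\mathcal F$ and all $k$. **Uniform convergence level.** For $n\in\mathbb N$ and $\delta>0$ let $\zeta(n,\delta)\in[0,\infty]$ be the least $z$ such that, for every task $k$ and every sample size $m\ge n$, with probability at least $1-\delta$ over $m$ i.i.d. samples of $\mathfrak D_k$, $|L_k(f_\theta)-\hat L_k(f_\theta)|\le z$ for all $\theta\in\Theta$ simultaneously. **Theorem.** Let $\lambda^\star_u$ and $\lambda^\star_p$ maximize $g_u$ and $g_p$ over $\mathbb R^t_+$, let $n_k\ge1$ i.i.d. samples of each $\mathfrak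 D_k$ be given, let $\tilde n=\min_k n_k$ and $\delta\in(0,1)$. With probability at least $1-t\delta$, for every maximizer $\hat\lambda^\star_p$ of $\hat g_p$ over $\mathbb R^t_+$ and every $c>0$ such that $g_u$ is $c$-strongly concave on the segment between $\lambda^\star_u$ and $\hat\lambda^\star_p$, $$\|\hat\lambda^\star_p-\lambda^\star_u\|_2^2\le\frac2c\Big[M\nu\,(1+\|\hat\lambda^\star_p\|_1)+6\,\zeta(\tilde n,\delta)\,\big(1+\max\{\|\lambda^\star_p\|_1,\|\hat\lambda^\star_p\|_1\}\big)\Big].$$ Moreover, for every $K$ there is a constant $C>0$, depending only on $K$, with the following property. Suppose that in addition $|\ell(f_\theta(x),y)-\ell(f_{\theta'}(x),y)|\le M\|f_\theta-f_{\theta'}\|_{L_2}$ for all $\theta,\theta'$ and all $(x,y)$, that $|\ell(f_{\theta}(x),y)|\le MR$ for all $(x,y)$ and at least one $\theta$, and that the parameterized class has dimension at most $d\ge1$ in the sense that for every $0<r\le R$ it is covered by at most $(KR/r)^d$ $L_2$-balls of radius $r$ centred in the class. Then for all $n\ge2$ and $0<\delta\le\frac12$, $$\zeta(n,\delta)\le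 C\,\frac{RM\sqrt{d\,\log (n)\,\log(d/\delta)}}{\sqrt n}.$$ -/

import Mathlib

open MeasureTheory ProbabilityTheory
open scoped ENNReal

noncomputable section

/-- The most recent (current) task among the tasks `0, …, t - 1`. -/
def currentTask (t : ℕ) [NeZero t] : Fin t :=
  ⟨t - 1, Nat.sub_lt (NeZero.pos t) Nat.one_pos⟩

/-- A constrained continual learning problem with `t` tasks, inputs in `X`, labels in `Y`,
predictions in `V` and parameters in `Θ`. -/
structure CLProblem (t : ℕ) (X Y V Θ : Type*) [MeasurableSpace X] [MeasurableSpace Y]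
    [NormedAddCommGroup V] [NormedSpace ℝ V] where
  /-- the data distribution of each task -/
  D : Fin t → Measure (X × Y)
  prob : ∀ k, IsProbabilityMeasure (D k)
  /-- the loss `ℓ (f x) y` of predicting `f x` when the label is `y` -/
  loss : V → Y → ℝ
  /-- the forgetting tolerance of each task -/
  tol : Fin t → ℝ
  /-- the measure on the inputs that defines the `L²` norm of predictors -/
  base : Measure X
  /-- the functional space -/
  F : Set (X → V)
  memLp : ∀ f ∈ F, MemLp f 2 base
  integrable : ∀ f ∈ F, ∀ k, Integrable (fun z : X × Y => loss (f z.1) z.2) (D k)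
  /-- the parameterization `θ ↦ f_θ` -/
  model : Θ → X → V
  model_mem : ∀ θ, model θ ∈ F

namespace CLProblem

variable {t : ℕ} {X Y V Θ : Type*} [MeasurableSpace X] [MeasurableSpace Y]
  [NormedAddCommGroup V] [NormedSpace ℝ V]

/-- The `L²` distance between two predictors (it is finite on `P.F`). -/
def dist2 (P : CLProblem t X Y V Θ) (f g : X → V) : ℝ :=
  (eLpNorm (f - g) 2 P.base).toReal

/-- The statistical risk of `f` on task `k`. -/
def risk (P : CLProblem t X Y V Θ) (k : Fin t) (f : X → V) : ℝ :=
  ∫ z, P.loss (f z.1) z.2 ∂(P.D k)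

/-- The empirical risk of `f` on the sample `S`. -/
def empRisk (P : CLProblem t X Y V Θ) {m : ℕ} (S : Fin m → X × Y) (f : X → V) : ℝ :=
  (1 / (m : ℝ)) * ∑ i, P.loss (f (S i).1) (S i).2

/-- The statistical Lagrangian. -/
def lagrangian (P : CLProblem t X Y V Θ) [NeZero t] (f : X → V)
    (lam : EuclideanSpace ℝ (Fin t)) : ℝ :=
  P.risk (currentTask t) f + ∑ k, lam k * (P.risk k f - P.tol k)

/-- The empirical Lagrangian, for a sample `S k` of size `n k` from each task `k`. -/
def empLagrangian (P : CLProblem t X Y V Θ) [NeZero t] {n : Fin t → ℕ}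
    (S : ∀ k, Fin (n k) → X × Y) (f : X → V) (lam : EuclideanSpace ℝ (Fin t)) : ℝ :=
  P.empRisk (S (currentTask t)) f + ∑ k, lam k * (P.empRisk (S k) f - P.tol k)

/-- The unparameterized dual function `g_u`. -/
def dualU (P : CLProblem t X Y V Θ) [NeZero t] (lam : EuclideanSpace ℝ (Fin t)) : ℝ :=
  ⨅ f : P.F, P.lagrangian f lam

/-- The parameterized dual function `g_p`. -/
def dualP (P : CLProblem t X Y V Θ) [NeZero t] (lam : EuclideanSpace ℝ (Fin t)) : ℝ :=
  ⨅ θ : Θ, P.lagrangian (P.model θ) lam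

/-- The empirical parameterized dual function `ĝ_p`. -/
def empDualP (P : CLProblem t X Y V Θ) [NeZero t] {n : Fin t → ℕ}
    (S : ∀ k, Fin (n k) → X × Y) (lam : EuclideanSpace ℝ (Fin t)) : ℝ :=
  ⨅ θ : Θ, P.empLagrangian S (P.model θ) lam

/-- Constraint qualification: the space `F` and the loss (as a function of the predictor) are
convex, and there is a strictly feasible predictor. -/
def ConstraintQualification (P : CLProblem t X Y V Θ) : Prop :=
  Convex ℝ P.F ∧ (∀ x y, ConvexOn ℝ P.F (fun f => P.loss (f x) y)) ∧
    ∃ f ∈ P.F, ∀ k, P.risk k f < P.tol k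

/-- Near-universality of the parameterization, with constant `ν`. -/
def NearUniversal (P : CLProblem t X Y V Θ) (ν : ℝ) : Prop :=
  ∀ f ∈ P.F, ∃ θ, P.dist2 f (P.model θ) ≤ ν

/-- `F` is bounded by `R` in `L²`, and the loss is `M`-Lipschitz in the predictor, from the
`L²` norm to the `L¹` norm of the data distribution of each task. This holds in particular if
`|ℓ (f x) y - ℓ (g x) y| ≤ M * ‖f - g‖` at every data point, and also if `ℓ (·) y` is
`M`-Lipschitz for every label and the `L²` norm dominates the one of each input distribution. -/
def BoundedLipschitz (P : CLProblem t X Y V Θ) (R M : ℝ) : Prop :=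
  (∀ f ∈ P.F, P.dist2 f 0 ≤ R) ∧
    ∀ f ∈ P.F, ∀ g ∈ P.F, ∀ k,
      ∫ z, |P.loss (f z.1) z.2 - P.loss (g z.1) z.2| ∂(P.D k) ≤ M * P.dist2 f g

/-- On the parameterized class the loss is `M`-Lipschitz in the predictor at every data point, and
it is bounded by `M * R` for at least one parameter. -/
def PointwiseBoundedLipschitz (P : CLProblem t X Y V Θ) (R M : ℝ) : Prop :=
  (∀ θ θ' x y, |P.loss (P.model θ x) y - P.loss (P.model θ' x) y| ≤
      M * P.dist2 (P.model θ) (P.model θ')) ∧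
    ∃ θ, ∀ x y, |P.loss (P.model θ x) y| ≤ M * R

/-- The parameterized class has metric dimension at most `d` in `L²`, at scale `R` and with
constant `K`: for `0 < r ≤ R` it is covered by at most `(K * R / r) ^ d` balls of radius `r`.
With `K = 3` this holds for every class of `L²` radius at most `R` in a `d`-dimensional subspace;
it also holds, for a suitable `K`, if `Θ` is a bounded set in `ℝ^d` and `θ ↦ f_θ` is Lipschitz. -/
def HasMetricDim (P : CLProblem t X Y V Θ) (K R : ℝ) (d : ℕ) : Prop :=
  ∀ r : ℝ, 0 < r → r ≤ R → ∃ s : Finset Θ, (s.card : ℝ) ≤ (K * R / r) ^ d ∧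
    ∀ θ, ∃ θ' ∈ s, P.dist2 (P.model θ) (P.model θ') ≤ r

/-- The uniform convergence level `ζ(n, δ)` of the parameterized class: the least `z` such that,
for every task and every sample size `m ≥ n`, with probability at least `1 - δ` over `m`
independent samples of the task, the statistical and the empirical risks differ by at most `z`
simultaneously for all parameters. It is `∞` if there is no such finite `z`. -/
def zeta (P : CLProblem t X Y V Θ) (n : ℕ) (δ : ℝ) : ℝ≥0∞ :=
  sInf {z : ℝ≥0∞ | ∀ (k : Fin t) (m : ℕ), n ≤ m →
    Measure.pi (fun _ : Fin m => P.D k)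
      {S | ∃ θ, z < ENNReal.ofReal |P.risk k (P.model θ) - P.empRisk S (P.model θ)|}
        ≤ ENNReal.ofReal δ}

end CLProblem

/-- The `ℓ¹` norm of a vector of dual variables. -/
def norm1 {t : ℕ} (lam : EuclideanSpace ℝ (Fin t)) : ℝ := ∑ k, |lam k|

/-- `lam` maximizes the dual function `g` over the nonnegative orthant. -/
def IsDualOptimal {t : ℕ} (g : EuclideanSpace ℝ (Fin t) → ℝ)
    (lam : EuclideanSpace ℝ (Fin t)) : Prop :=
  (∀ k, 0 ≤ lam k) ∧ ∀ lam' : EuclideanSpace ℝ (Fin t), (∀ k, 0 ≤ lam' k) → g lam' ≤ g lam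

end

noncomputable section

/-! The distance between the multipliers is read off from a dual gap. A `c`-strongly concave
function grows quadratically away from its maximizer, so it suffices to bound `g_u(λ_u) - g_u(λ̂)`.
This is a chain of comparisons: pass from `g_u` to `g_p` at `λ_u`, use optimality of `λ_p`, pass to
`ĝ_p` at `λ_p`, use optimality of `λ̂`, and return through `g_p` to `g_u` at `λ̂`. Each change of
dual function costs a uniform error in the risks times `1 + ‖λ‖₁` (`abs_lagrange_sub_le`): `M ν` for
the parameterization, the uniform deviation for sampling. `norm_dual_sub_sq_le` is this
deterministic argument. The only random input is that every task has deviation at most `zeta`, which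
a union bound over the tasks provides.

The rate comes from a one-scale net argument: at sample size `m`, cover the class at radius `R /
√m`, apply Hoeffding at each centre, and transfer to the whole class by the Lipschitz property. The
net contributes about `d log (K √m)` to the exponent; this logarithm and the confidence term are
absorbed in `log_net_le`, uniformly in `m ≥ n`. -/

/-! ### Perturbation of Lagrangians and quadratic growth -/

lemma norm1_nonneg {t : ℕ} (lam : EuclideanSpace ℝ (Fin t)) : 0 ≤ norm1 lam :=
  Finset.sum_nonneg fun _ _ => abs_nonneg _

/-- Risks that differ by at most `e` give Lagrangians that differ by at most
`e * (1 + ‖lam‖₁)`. -/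
lemma abs_lagrange_sub_le {t : ℕ} (a b tol : Fin t → ℝ) (lam : EuclideanSpace ℝ (Fin t))
    (i : Fin t) {e : ℝ} (h : ∀ k, |a k - b k| ≤ e) :
    |(a i + ∑ k, lam k * (a k - tol k)) - (b i + ∑ k, lam k * (b k - tol k))|
      ≤ e * (1 + norm1 lam) := by
  have h1 : (a i + ∑ k, lam k * (a k - tol k)) - (b i + ∑ k, lam k * (b k - tol k))
      = (a i - b i) + ∑ k, lam k * (a k - b k) := by
    rw [add_sub_add_comm, ← Finset.sum_sub_distrib]
    congr 1
    exact Finset.sum_congr rfl fun k _ => by ring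
  have h2 : |∑ k, lam k * (a k - b k)| ≤ ∑ k, |lam k| * e :=
    (Finset.abs_sum_le_sum_abs _ _).trans <| Finset.sum_le_sum fun k _ => by
      rw [abs_mul]
      exact mul_le_mul_of_nonneg_left (h k) (abs_nonneg _)
  rw [h1]
  calc |(a i - b i) + ∑ k, lam k * (a k - b k)| ≤ e + ∑ k, |lam k| * e :=
        (abs_add_le _ _).trans (add_le_add (h i) h2)
    _ = e * (1 + norm1 lam) := by rw [norm1, ← Finset.sum_mul]; ring

/-- Quadratic growth of a strongly concave function away from its maximum. -/
lemma StrongConcaveOn.norm_sub_sq_le {E : Type*} [NormedAddCommGroup E] [NormedSpace ℝ E]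
    {s : Set E} {g : E → ℝ} {c : ℝ} {u v : E} (hg : StrongConcaveOn s c g) (hc : 0 < c)
    (hu : u ∈ s) (hv : v ∈ s) (hmax : ∀ w ∈ s, g w ≤ g u) :
    ‖v - u‖ ^ 2 ≤ 2 / c * (g u - g v) := by
  -- Compare the value at `a u + (1 - a) v` with the maximum: a factor `1 - a` cancels, and letting
  -- `a → 1` afterwards recovers the full constant `c / 2`.
  have key : ∀ a : ℝ, 0 ≤ a → a < 1 → a * (c / 2 * ‖u - v‖ ^ 2) ≤ g u - g v := by
    intro a ha ha1
    have h := hg.2 hu hv ha (sub_nonneg.2 ha1.le) (by ring)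
    have h' := hmax _ (hg.1 hu hv ha (sub_nonneg.2 ha1.le) (by ring))
    simp only [smul_eq_mul] at h
    have h3 : (1 - a) * (a * (c / 2 * ‖u - v‖ ^ 2)) ≤ (1 - a) * (g u - g v) := by linarith
    exact le_of_mul_le_mul_left h3 (by linarith)
  have h1 : c / 2 * ‖u - v‖ ^ 2 ≤ g u - g v := by
    have h2 : Filter.Tendsto (fun a : ℝ => a * (c / 2 * ‖u - v‖ ^ 2)) (nhdsWithin 1 (Set.Iio 1))
        (nhds (1 * (c / 2 * ‖u - v‖ ^ 2))) :=
      ((continuous_id.mul continuous_const).tendsto 1).mono_left nhdsWithin_le_nhds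
    rw [one_mul] at h2
    refine le_of_tendsto h2 ?_
    filter_upwards [Ioo_mem_nhdsLT (show (0 : ℝ) < 1 by norm_num)] with a ha
    exact key a ha.1.le ha.2
  rw [norm_sub_rev]
  calc ‖u - v‖ ^ 2 = 2 / c * (c / 2 * ‖u - v‖ ^ 2) := by field_simp
    _ ≤ _ := by gcongr

/-! ### Concentration and product laws -/

/-- Two-sided Hoeffding inequality for the mean of a bounded function of an i.i.d. sample. -/
lemma measure_abs_integral_sub_mean_ge_le {α : Type*} [MeasurableSpace α] (D : Measure α)
    [IsProbabilityMeasure D] {g : α → ℝ} {B ε : ℝ} (hg : AEMeasurable g D)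
    (hB : ∀ x, |g x| ≤ B) {m : ℕ} (hm : 0 < m) (hε : 0 ≤ ε) :
    Measure.pi (fun _ : Fin m => D) {S | ε ≤ |∫ x, g x ∂D - (1 / (m : ℝ)) * ∑ i, g (S i)|}
      ≤ ENNReal.ofReal (2 * Real.exp (-(m * ε ^ 2 / (2 * B ^ 2)))) := by
  have hm' : (0 : ℝ) < m := by exact_mod_cast hm
  have hB0 : 0 ≤ B := by
    have : Nonempty α := nonempty_of_isProbabilityMeasure D
    exact (abs_nonneg _).trans (hB (Classical.arbitrary α))
  have tail : ∀ h : α → ℝ, AEMeasurable h D → (∀ x, |h x| ≤ B) →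
      (Measure.pi (fun _ : Fin m => D)).real {S | m * ε ≤ ∑ i, (h (S i) - ∫ x, h x ∂D)}
        ≤ Real.exp (-(m * ε ^ 2 / (2 * B ^ 2))) := by
    intro h hh hhB
    have hsub : HasSubgaussianMGF (fun x => h x - ∫ x, h x ∂D) ((‖B - -B‖₊ / 2) ^ 2) D :=
      hasSubgaussianMGF_of_mem_Icc hh (Filter.Eventually.of_forall fun x => abs_le.1 (hhB x))
    have hind : iIndepFun (fun (i : Fin m) (S : Fin m → α) => h (S i) - ∫ x, h x ∂D)
        (Measure.pi (fun _ : Fin m => D)) :=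
      iIndepFun_pi (X := fun _ x => h x - ∫ x, h x ∂D) fun _ => hh.sub_const _
    have hsub' : ∀ i ∈ (Finset.univ : Finset (Fin m)),
        HasSubgaussianMGF (fun S : Fin m → α => h (S i) - ∫ x, h x ∂D)
          ((‖B - -B‖₊ / 2) ^ 2) (Measure.pi (fun _ : Fin m => D)) := by
      intro i _
      have hmp := measurePreserving_eval (fun _ : Fin m => D) i
      refine HasSubgaussianMGF.of_map (Y := Function.eval i)
        (X := fun x => h x - ∫ x, h x ∂D) hmp.measurable.aemeasurable ?_
      rw [hmp.map_eq]
      exact hsub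
    have := HasSubgaussianMGF.measure_sum_ge_le_of_iIndepFun hind hsub'
      (mul_nonneg hm'.le hε)
    refine this.trans (le_of_eq ?_)
    congr 1
    have hn : ‖B - -B‖ = 2 * B := by
      rw [sub_neg_eq_add, Real.norm_eq_abs, abs_of_nonneg (by positivity)]; ring
    simp only [Finset.sum_const, Finset.card_univ, Fintype.card_fin, nsmul_eq_mul]
    push_cast
    rw [hn]
    -- For `B = 0` both exponents are divisions by zero, hence `0`, and the two bounds agree.
    rcases hB0.eq_or_lt with rfl | hBpos
    · simp
    · field_simp
  have h1 := tail g hg hB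
  have h2 := tail (fun x => -g x) hg.neg (fun x => by rw [abs_neg]; exact hB x)
  have hsum : ∀ S : Fin m → α, ∑ i, (g (S i) - ∫ x, g x ∂D)
      = ∑ i, g (S i) - m * ∫ x, g x ∂D := by
    intro S
    simp [Finset.sum_sub_distrib]
  have hsum' : ∀ S : Fin m → α, ∑ i, (-g (S i) - ∫ x, -g x ∂D)
      = m * ∫ x, g x ∂D - ∑ i, g (S i) := by
    intro S
    simp only [Finset.sum_sub_distrib, Finset.sum_neg_distrib, integral_neg, Finset.sum_const,
      Finset.card_univ, Fintype.card_fin, nsmul_eq_mul]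
    ring
  have hset : {S : Fin m → α | ε ≤ |∫ x, g x ∂D - (1 / (m : ℝ)) * ∑ i, g (S i)|} ⊆
      {S | m * ε ≤ ∑ i, (g (S i) - ∫ x, g x ∂D)} ∪
        {S | m * ε ≤ ∑ i, (-g (S i) - ∫ x, -g x ∂D)} := by
    intro S hS
    simp only [Set.mem_ofPred_eq] at hS
    have he : (m : ℝ) * (∫ x, g x ∂D - (1 / (m : ℝ)) * ∑ i, g (S i))
        = m * ∫ x, g x ∂D - ∑ i, g (S i) := by field_simp
    rcases le_abs.1 hS with h | h
    · right
      simp only [Set.mem_ofPred_eq, hsum']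
      rw [← he]
      exact mul_le_mul_of_nonneg_left h hm'.le
    · left
      simp only [Set.mem_ofPred_eq, hsum]
      have := mul_le_mul_of_nonneg_left h hm'.le
      linarith
  rw [two_mul, ENNReal.ofReal_add (Real.exp_pos _).le (Real.exp_pos _).le]
  refine (measure_mono hset).trans ((measure_union_le _ _).trans (add_le_add ?_ ?_))
  · rw [← ofReal_measureReal]
    exact ENNReal.ofReal_le_ofReal h1
  · rw [← ofReal_measureReal]
    exact ENNReal.ofReal_le_ofReal h2

/-- The joint law of independent variables with laws `D i` is the product measure. The
event `A` need not be measurable. -/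
lemma measure_le_pi_of_iIndepFun {Ω ι α : Type*} [Fintype ι] [MeasurableSpace Ω]
    [MeasurableSpace α] {μ : Measure Ω} [IsProbabilityMeasure μ] {D : Measure α}
    {Z : ι → Ω → α} (hlaw : ∀ i, HasLaw (Z i) D μ) (hind : iIndepFun Z μ)
    (A : Set (ι → α)) :
    μ {ω | (fun i => Z i ω) ∈ A} ≤ Measure.pi (fun _ : ι => D) A := by
  have hmap := (iIndepFun_iff_map_fun_eq_pi_map fun i => (hlaw i).aemeasurable).1 hind
  simp only [(hlaw _).map_eq] at hmap
  rw [← hmap]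
  exact Measure.le_map_apply (aemeasurable_pi_lambda _ fun i => (hlaw i).aemeasurable) A

/-! ### Gaps between the three dual functions -/

namespace CLProblem

variable {t : ℕ} {X Y V Θ : Type*} [MeasurableSpace X] [MeasurableSpace Y]
  [NormedAddCommGroup V] [NormedSpace ℝ V]

lemma dist2_le_add (P : CLProblem t X Y V Θ) {f g : X → V} (hf : f ∈ P.F) (hg : g ∈ P.F) :
    P.dist2 f g ≤ P.dist2 f 0 + P.dist2 g 0 := by
  unfold dist2
  rw [sub_zero, sub_zero, ← ENNReal.toReal_add (P.memLp f hf).2.ne (P.memLp g hg).2.ne]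
  exact ENNReal.toReal_mono (ENNReal.add_ne_top.2 ⟨(P.memLp f hf).2.ne, (P.memLp g hg).2.ne⟩)
    (eLpNorm_sub_le (P.memLp f hf).1 (P.memLp g hg).1 (by norm_num))

lemma BoundedLipschitz.dist2_le {P : CLProblem t X Y V Θ} {R M : ℝ}
    (h : P.BoundedLipschitz R M) {f g : X → V} (hf : f ∈ P.F) (hg : g ∈ P.F) :
    P.dist2 f g ≤ 2 * R := by
  linarith [P.dist2_le_add hf hg, h.1 f hf, h.1 g hg]

lemma BoundedLipschitz.abs_risk_sub_le {P : CLProblem t X Y V Θ} {R M : ℝ}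
    (h : P.BoundedLipschitz R M) {f g : X → V} (hf : f ∈ P.F) (hg : g ∈ P.F) (k : Fin t) :
    |P.risk k f - P.risk k g| ≤ M * P.dist2 f g := by
  unfold risk
  rw [← integral_sub (P.integrable f hf k) (P.integrable g hg k)]
  exact abs_integral_le_integral_abs.trans (h.2 f hf g hg k)

lemma BoundedLipschitz.abs_lagrangian_sub_le [NeZero t] {P : CLProblem t X Y V Θ} {R M r : ℝ}
    (h : P.BoundedLipschitz R M) (hM : 0 ≤ M) {f g : X → V} (hf : f ∈ P.F) (hg : g ∈ P.F)
    (hr : P.dist2 f g ≤ r) (lam : EuclideanSpace ℝ (Fin t)) :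
    |P.lagrangian f lam - P.lagrangian g lam| ≤ M * r * (1 + norm1 lam) :=
  abs_lagrange_sub_le _ _ _ _ _ fun k =>
    (h.abs_risk_sub_le hf hg k).trans (mul_le_mul_of_nonneg_left hr hM)

/-- `F` has diameter at most `2 R`, so a Lipschitz Lagrangian cannot drop far below its value at
`f₀`. This makes the real-valued infima genuine: an infimum unbounded below would take the default
value `0`. -/
lemma BoundedLipschitz.exists_le_lagrangian [NeZero t] {P : CLProblem t X Y V Θ} {R M : ℝ}
    (h : P.BoundedLipschitz R M) (hM : 0 ≤ M) {f₀ : X → V} (hf₀ : f₀ ∈ P.F)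
    (lam : EuclideanSpace ℝ (Fin t)) : ∃ b, ∀ f ∈ P.F, b ≤ P.lagrangian f lam := by
  refine ⟨P.lagrangian f₀ lam - M * (2 * R) * (1 + norm1 lam), fun f hf => ?_⟩
  have := (abs_le.1 (h.abs_lagrangian_sub_le hM hf hf₀ (h.dist2_le hf hf₀) lam)).1
  linarith

lemma dualU_le_dualP [NeZero t] {P : CLProblem t X Y V Θ} {R M : ℝ} [Nonempty Θ]
    (h : P.BoundedLipschitz R M) (hM : 0 ≤ M) (lam : EuclideanSpace ℝ (Fin t)) :
    P.dualU lam ≤ P.dualP lam := by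
  obtain ⟨θ₀⟩ := ‹Nonempty Θ›
  have : Nonempty Θ := ⟨θ₀⟩
  obtain ⟨b, hb⟩ := h.exists_le_lagrangian hM (P.model_mem θ₀) lam
  refine le_ciInf fun θ => ?_
  exact ciInf_le (f := fun f : P.F => P.lagrangian f lam)
    ⟨b, by rintro _ ⟨f, rfl⟩; exact hb f f.2⟩ ⟨P.model θ, P.model_mem θ⟩

/-- The parameterization gap of the dual function. -/
lemma dualP_le_dualU_add [NeZero t] {P : CLProblem t X Y V Θ} {R M ν : ℝ} [Nonempty P.F]
    (h : P.BoundedLipschitz R M) (hM : 0 ≤ M) (hν : P.NearUniversal ν)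
    (lam : EuclideanSpace ℝ (Fin t)) :
    P.dualP lam ≤ P.dualU lam + M * ν * (1 + norm1 lam) := by
  rw [← sub_le_iff_le_add]
  refine le_ciInf fun f => ?_
  obtain ⟨θ, hθ⟩ := hν f f.2
  obtain ⟨b, hb⟩ := h.exists_le_lagrangian hM f.2 lam
  have h1 : P.dualP lam ≤ P.lagrangian (P.model θ) lam :=
    ciInf_le (f := fun θ => P.lagrangian (P.model θ) lam)
      ⟨b, by rintro _ ⟨θ, rfl⟩; exact hb _ (P.model_mem θ)⟩ θ
  have h2 := (abs_le.1 (h.abs_lagrangian_sub_le hM f.2 (P.model_mem θ) hθ lam)).1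
  linarith

/-- The estimation gap of the parameterized dual function. -/
lemma abs_dualP_sub_empDualP_le [NeZero t] {P : CLProblem t X Y V Θ} {R M e : ℝ} [Nonempty Θ]
    (h : P.BoundedLipschitz R M) (hM : 0 ≤ M) {n : Fin t → ℕ} {S : ∀ k, Fin (n k) → X × Y}
    (hS : ∀ k θ, |P.risk k (P.model θ) - P.empRisk (S k) (P.model θ)| ≤ e)
    (lam : EuclideanSpace ℝ (Fin t)) :
    |P.dualP lam - P.empDualP S lam| ≤ e * (1 + norm1 lam) := by
  obtain ⟨θ₀⟩ := ‹Nonempty Θ›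
  have : Nonempty Θ := ⟨θ₀⟩
  obtain ⟨b, hb⟩ := h.exists_le_lagrangian hM (P.model_mem θ₀) lam
  have hd : ∀ θ, |P.lagrangian (P.model θ) lam - P.empLagrangian S (P.model θ) lam|
      ≤ e * (1 + norm1 lam) := fun θ =>
    abs_lagrange_sub_le (fun k => P.risk k (P.model θ)) (fun k => P.empRisk (S k) (P.model θ))
      P.tol lam (currentTask t) fun k => hS k θ
  suffices h' : P.empDualP S lam - e * (1 + norm1 lam) ≤ P.dualP lam ∧
      P.dualP lam - e * (1 + norm1 lam) ≤ P.empDualP S lam by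
    rw [abs_le]
    constructor <;> linarith [h'.1, h'.2]
  refine ⟨le_ciInf fun θ => ?_, le_ciInf fun θ => ?_⟩
  · have h1 : P.empDualP S lam ≤ P.empLagrangian S (P.model θ) lam :=
      ciInf_le (f := fun θ => P.empLagrangian S (P.model θ) lam)
        -- The empirical Lagrangian inherits its lower bound from the statistical one.
        ⟨b - e * (1 + norm1 lam), by
          rintro _ ⟨θ, rfl⟩
          linarith [(abs_le.1 (hd θ)).2, hb _ (P.model_mem θ)]⟩ θ
    linarith [(abs_le.1 (hd θ)).1]
  · have h1 : P.dualP lam ≤ P.lagrangian (P.model θ) lam :=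
      ciInf_le (f := fun θ => P.lagrangian (P.model θ) lam)
        ⟨b, by rintro _ ⟨θ, rfl⟩; exact hb _ (P.model_mem θ)⟩ θ
    linarith [(abs_le.1 (hd θ)).2]

/-- If the empirical risks are uniformly `e`-close to the statistical ones, the dual optimum of
the empirical problem is close to the unparameterized one. -/
lemma norm_dual_sub_sq_le [NeZero t] {P : CLProblem t X Y V Θ} {R M ν e c : ℝ}
    [Nonempty Θ] (h : P.BoundedLipschitz R M) (hM : 0 ≤ M) (hν : P.NearUniversal ν) (he : 0 ≤ e)
    {n : Fin t → ℕ} {S : ∀ k, Fin (n k) → X × Y}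
    (hS : ∀ k θ, |P.risk k (P.model θ) - P.empRisk (S k) (P.model θ)| ≤ e)
    {lamU lamP lamHat : EuclideanSpace ℝ (Fin t)}
    (hU : IsDualOptimal P.dualU lamU) (hP : IsDualOptimal P.dualP lamP)
    (hHat : IsDualOptimal (P.empDualP S) lamHat) (hc : 0 < c)
    (hconc : StrongConcaveOn (segment ℝ lamU lamHat) c P.dualU) :
    ‖lamHat - lamU‖ ^ 2 ≤ 2 / c * (M * ν * (1 + norm1 lamHat) +
      6 * e * (1 + max (norm1 lamP) (norm1 lamHat))) := by
  have : Nonempty P.F := ⟨⟨_, P.model_mem (Classical.arbitrary Θ)⟩⟩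
  -- The segment stays in the convex nonnegative orthant, over which `lamU` is optimal.
  have hmax : ∀ w ∈ segment ℝ lamU lamHat, P.dualU w ≤ P.dualU lamU := by
    rintro w ⟨a, b, ha, hb, -, rfl⟩
    refine hU.2 _ fun k => ?_
    have := add_nonneg (mul_nonneg ha (hU.1 k)) (mul_nonneg hb (hHat.1 k))
    simpa using this
  refine (hconc.norm_sub_sq_le hc (left_mem_segment ..) (right_mem_segment ..) hmax).trans ?_
  gcongr
  -- `h1` to `h6` form the chain `g_u(λ_u) ≤ g_p(λ_u) ≤ g_p(λ_p) ≲ ĝ_p(λ_p) ≤ ĝ_p(λ̂) ≲ g_p(λ̂) ≲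
  -- g_u(λ̂)`. It pays the sampling error only twice; `h9` relaxes the factor `2` to `6`.
  have h1 := dualU_le_dualP h hM lamU
  have h2 := hP.2 lamU hU.1
  have h3 := (abs_le.1 (abs_dualP_sub_empDualP_le h hM hS lamP)).2
  have h4 := hHat.2 lamP hP.1
  have h5 := (abs_le.1 (abs_dualP_sub_empDualP_le h hM hS lamHat)).1
  have h6 := dualP_le_dualU_add h hM hν lamHat
  have h7 : e * (1 + norm1 lamP) ≤ e * (1 + max (norm1 lamP) (norm1 lamHat)) := by
    gcongr; exact le_max_left _ _
  have h8 : e * (1 + norm1 lamHat) ≤ e * (1 + max (norm1 lamP) (norm1 lamHat)) := by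
    gcongr; exact le_max_right _ _
  have h9 : 0 ≤ e * (1 + max (norm1 lamP) (norm1 lamHat)) :=
    mul_nonneg he (by linarith [norm1_nonneg lamP, le_max_left (norm1 lamP) (norm1 lamHat)])
  linarith

/-! ### From the uniform convergence level to the probabilistic bound -/

/-- The infimum that defines `zeta` is attained. -/
lemma measure_zeta_lt_le (P : CLProblem t X Y V Θ) {n m : ℕ} (δ : ℝ) (k : Fin t) (hm : n ≤ m) :
    Measure.pi (fun _ : Fin m => P.D k)
      {S | ∃ θ, P.zeta n δ < ENNReal.ofReal |P.risk k (P.model θ) - P.empRisk S (P.model θ)|}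
        ≤ ENNReal.ofReal δ := by
  let A : Set ℝ≥0∞ := {z : ℝ≥0∞ | ∀ (k : Fin t) (m : ℕ), n ≤ m →
    Measure.pi (fun _ : Fin m => P.D k)
      {S | ∃ θ, z < ENNReal.ofReal |P.risk k (P.model θ) - P.empRisk S (P.model θ)|}
        ≤ ENNReal.ofReal δ}
  have hA : A.Nonempty := ⟨⊤, fun k m _ => by simp⟩
  -- Admissible levels decreasing to the infimum have increasing bad events, whose union contains
  -- the bad event at the infimum; continuity from below then applies.
  obtain ⟨u, hu, hlim, hmem⟩ := exists_seq_tendsto_sInf hA (OrderBot.bddBelow A)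
  have hset : {S : Fin m → X × Y |
      ∃ θ, P.zeta n δ < ENNReal.ofReal |P.risk k (P.model θ) - P.empRisk S (P.model θ)|} ⊆
      ⋃ j, {S | ∃ θ, u j < ENNReal.ofReal |P.risk k (P.model θ) - P.empRisk S (P.model θ)|} := by
    rintro S ⟨θ, hθ⟩
    obtain ⟨j, hj⟩ := (hlim.eventually_lt_const hθ).exists
    exact Set.mem_iUnion.2 ⟨j, θ, hj⟩
  refine (measure_mono hset).trans ?_
  rw [Monotone.measure_iUnion]
  · exact iSup_le fun j => hmem j k m hm
  · rintro i j hij S ⟨θ, hθ⟩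
    exact ⟨θ, (hu hij).trans_lt hθ⟩

/-- Outside the union of the `t` bad events the deterministic estimate holds for all `lamHat` and
`c` at once, so both may depend on the sample. The union bound needs independence only within each
task. -/
lemma measure_dual_bound_fails_le [NeZero t] {Ω : Type*} [MeasurableSpace Ω]
    {P : CLProblem t X Y V Θ} {R M ν : ℝ} [Nonempty Θ] (h : P.BoundedLipschitz R M) (hM : 0 ≤ M)
    (hν0 : 0 ≤ ν) (hν : P.NearUniversal ν) (μ : Measure Ω) [IsProbabilityMeasure μ]
    {n : Fin t → ℕ} {Z : ∀ k, Fin (n k) → Ω → X × Y} (δ : ℝ)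
    {lamU lamP : EuclideanSpace ℝ (Fin t)}
    (hlaw : ∀ k i, HasLaw (Z k i) (P.D k) μ) (hind : ∀ k, iIndepFun (Z k) μ)
    (hU : IsDualOptimal P.dualU lamU) (hP : IsDualOptimal P.dualP lamP) :
    μ {ω | ¬ ∀ (lamHat : EuclideanSpace ℝ (Fin t)) (c : ℝ),
        IsDualOptimal (P.empDualP (fun k i => Z k i ω)) lamHat →
        0 < c → StrongConcaveOn (segment ℝ lamU lamHat) c P.dualU →
        ENNReal.ofReal (‖lamHat - lamU‖ ^ 2) ≤
          ENNReal.ofReal (2 / c) *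
            (ENNReal.ofReal (M * ν * (1 + norm1 lamHat)) +
              6 * P.zeta (⨅ k, n k) δ *
                ENNReal.ofReal (1 + max (norm1 lamP) (norm1 lamHat)))}
      ≤ ENNReal.ofReal (t * δ) := by
  let bad (k : Fin t) : Set (Fin (n k) → X × Y) := {S | ∃ θ, P.zeta (⨅ k, n k) δ <
    ENNReal.ofReal |P.risk k (P.model θ) - P.empRisk S (P.model θ)|}
  have hbad : ∀ k, μ {ω | (fun i => Z k i ω) ∈ bad k} ≤ ENNReal.ofReal δ := fun k =>
    (measure_le_pi_of_iIndepFun (hlaw k) (hind k) (bad k)).trans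
      (P.measure_zeta_lt_le δ k (ciInf_le (OrderBot.bddBelow _) k))
  calc _ ≤ μ (⋃ k, {ω | (fun i => Z k i ω) ∈ bad k}) := measure_mono ?_
    _ ≤ ∑ k, μ {ω | (fun i => Z k i ω) ∈ bad k} := measure_iUnion_fintype_le _ _
    _ ≤ ∑ _k : Fin t, ENNReal.ofReal δ := Finset.sum_le_sum fun k _ => hbad k
    _ = ENNReal.ofReal (t * δ) := by
      rw [ENNReal.ofReal_mul (Nat.cast_nonneg t)]
      simp
  intro ω hω
  by_contra hgood
  refine hω fun lamHat c hHat hc hconc => ?_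
  have hmax : 0 < 1 + max (norm1 lamP) (norm1 lamHat) := by
    linarith [norm1_nonneg lamP, le_max_left (norm1 lamP) (norm1 lamHat)]
  -- If the level is infinite the right side is `⊤`, because the factors multiplying it are nonzero.
  by_cases htop : P.zeta (⨅ k, n k) δ = ⊤
  · have hx : ENNReal.ofReal (2 / c) ≠ 0 := by
      rw [Ne, ENNReal.ofReal_eq_zero, not_le]; positivity
    have hy : ENNReal.ofReal (1 + max (norm1 lamP) (norm1 lamHat)) ≠ 0 := by
      rw [Ne, ENNReal.ofReal_eq_zero, not_le]; exact hmax
    rw [htop, ENNReal.mul_top (by norm_num), ENNReal.top_mul hy, add_top, ENNReal.mul_top hx]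
    exact le_top
  · have hS : ∀ k θ, |P.risk k (P.model θ) - P.empRisk (fun i => Z k i ω) (P.model θ)|
        ≤ (P.zeta (⨅ k, n k) δ).toReal := by
      intro k θ
      rw [← ENNReal.ofReal_le_iff_le_toReal htop]
      by_contra hlt
      exact hgood (Set.mem_iUnion.2 ⟨k, θ, not_le.1 hlt⟩)
    have hmain := norm_dual_sub_sq_le h hM hν ENNReal.toReal_nonneg hS hU hP hHat hc hconc
    refine (ENNReal.ofReal_le_ofReal hmain).trans (le_of_eq ?_)
    have hn := norm1_nonneg lamHat
    rw [ENNReal.ofReal_mul (by positivity), ENNReal.ofReal_add (by positivity) (by positivity),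
      ENNReal.ofReal_mul (p := 6 * _) (by positivity), ENNReal.ofReal_mul (p := 6) (by norm_num),
      ENNReal.ofReal_toReal htop, ENNReal.ofReal_ofNat]

end CLProblem

/-! ### The covering rate for the uniform convergence level -/

/-- The log-cardinality of a `1 / √m`-net in dimension `d` and the confidence term, bounded by a
rate at any smaller sample size `n`. -/
lemma log_net_le {n m d : ℕ} {a δ : ℝ} (hn : 2 ≤ n) (hm : n ≤ m) (hd : 1 ≤ d) (ha : 0 ≤ a)
    (hδ : 0 < δ) (hδ2 : δ ≤ 1 / 2) :
    Real.log 2 + d * a + d * (Real.log m / 2) + Real.log (1 / δ)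
      ≤ (9 + 4 * a) * (m / n * (d * Real.log n * Real.log (d / δ))) ∧
    1 ≤ 4 * (d * Real.log n * Real.log (d / δ)) := by
  have hn' : (2 : ℝ) ≤ n := by exact_mod_cast hn
  have hm' : (n : ℝ) ≤ m := by exact_mod_cast hm
  have hd' : (1 : ℝ) ≤ d := by exact_mod_cast hd
  have hl2 := Real.log_two_gt_d9
  have hl2' := Real.log_two_lt_d9
  have hL : 1 / 2 ≤ Real.log n := by
    have := Real.log_le_log (by norm_num) hn'
    linarith
  have hdδ : 1 / δ ≤ d / δ := by gcongr
  have h1δ : 2 ≤ 1 / δ := by rw [le_div_iff₀ hδ]; linarith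
  have hD : 1 / 2 ≤ Real.log (d / δ) := by
    have := Real.log_le_log (by norm_num) (h1δ.trans hdδ)
    linarith
  have hD1 : Real.log (1 / δ) ≤ Real.log (d / δ) := Real.log_le_log (by positivity) hdδ
  have hx : (1 : ℝ) ≤ m / n := by rw [le_div_iff₀ (by linarith)]; linarith
  -- `log (m / n) ≤ m / n` trades the logarithm of the actual sample size for a factor that the
  -- Hoeffding exponent also carries.
  have hlogm : Real.log m ≤ Real.log n + m / n := by
    have h1 : Real.log m = Real.log n + Real.log (m / n) := by
      rw [← Real.log_mul (by positivity) (by positivity)]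
      congr 1
      field_simp
    have h2 := Real.log_le_sub_one_of_pos (show (0 : ℝ) < m / n by linarith)
    linarith
  generalize Real.log n = L at *
  generalize Real.log (d / δ) = D at *
  generalize (m : ℝ) / n = x at *
  generalize (d : ℝ) = d' at *
  -- Both logarithms are at least `1 / 2`, since `n ≥ 2` and `d / δ ≥ 2`. The constant `9 + 4 a` is
  -- the sum of the contributions `4`, `4 a`, `1`, `2`, `2` of `e1` to `e5`.
  have hLD : 1 ≤ 4 * (L * D) := by nlinarith
  have hdA : d' ≤ 4 * (d' * L * D) := by nlinarith
  have hA1 : 1 ≤ 4 * (d' * L * D) := hd'.trans hdA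
  have hA0 : 0 ≤ d' * L * D := by linarith
  refine ⟨?_, hA1⟩
  have hxA : d' * L * D ≤ x * (d' * L * D) := by nlinarith
  have e1 : Real.log 2 ≤ 4 * (x * (d' * L * D)) := by linarith
  have e2 : d' * a ≤ 4 * a * (x * (d' * L * D)) := by nlinarith
  have hdL : 0 ≤ d' * L := by nlinarith
  have e3 : d' * L / 2 ≤ x * (d' * L * D) := by nlinarith
  have e4 : d' * x / 2 ≤ 2 * (x * (d' * L * D)) := by nlinarith
  have e5 : Real.log (1 / δ) ≤ 2 * (x * (d' * L * D)) := by
    have : 1 ≤ 2 * (d' * L) := by nlinarith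
    nlinarith
  have e6 : d' * (Real.log m / 2) ≤ d' * L / 2 + d' * x / 2 := by nlinarith
  linarith

namespace CLProblem

variable {t : ℕ} {X Y V Θ : Type*} [MeasurableSpace X] [MeasurableSpace Y]
  [NormedAddCommGroup V] [NormedSpace ℝ V]

/-- `M R` at the reference parameter, plus `M` times the diameter `2 R`. -/
lemma PointwiseBoundedLipschitz.abs_loss_le {P : CLProblem t X Y V Θ} {R M : ℝ}
    (h : P.PointwiseBoundedLipschitz R M) (hb : P.BoundedLipschitz R M) (hM : 0 ≤ M)
    (θ : Θ) (x : X) (y : Y) : |P.loss (P.model θ x) y| ≤ 3 * (M * R) := by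
  obtain ⟨θ₀, h₀⟩ := h.2
  have h1 := (h.1 θ θ₀ x y).trans
    (mul_le_mul_of_nonneg_left (hb.dist2_le (P.model_mem θ) (P.model_mem θ₀)) hM)
  have h2 := h₀ x y
  have h3 := abs_sub_abs_le_abs_sub (P.loss (P.model θ x) y) (P.loss (P.model θ₀ x) y)
  linarith

lemma PointwiseBoundedLipschitz.abs_empRisk_sub_le {P : CLProblem t X Y V Θ} {R M : ℝ}
    (h : P.PointwiseBoundedLipschitz R M) {m : ℕ} (hm : 0 < m) (S : Fin m → X × Y) (θ θ' : Θ) :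
    |P.empRisk S (P.model θ) - P.empRisk S (P.model θ')|
      ≤ M * P.dist2 (P.model θ) (P.model θ') := by
  have hm' : (0 : ℝ) < m := by exact_mod_cast hm
  unfold empRisk
  rw [← mul_sub, ← Finset.sum_sub_distrib, abs_mul, abs_of_pos (by positivity)]
  calc _ ≤ 1 / (m : ℝ) * ∑ _i : Fin m, M * P.dist2 (P.model θ) (P.model θ') := by
        gcongr
        exact (Finset.abs_sum_le_sum_abs _ _).trans (Finset.sum_le_sum fun i _ => h.1 _ _ _ _)
    _ = _ := by
        simp only [Finset.sum_const, Finset.card_univ, Fintype.card_fin, nsmul_eq_mul]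
        field_simp

/-- Deviation bound over the whole class from a finite `r`-net. -/
lemma measure_exists_deviation_le {P : CLProblem t X Y V Θ} {R M r ε : ℝ}
    (hb : P.BoundedLipschitz R M) (h : P.PointwiseBoundedLipschitz R M) (hM : 0 ≤ M)
    (s : Finset Θ) (hs : ∀ θ, ∃ θ' ∈ s, P.dist2 (P.model θ) (P.model θ') ≤ r) (k : Fin t)
    {m : ℕ} (hm : 0 < m) (hε : 0 ≤ ε) :
    Measure.pi (fun _ : Fin m => P.D k)
      {S | ∃ θ, ENNReal.ofReal (ε + 2 * (M * r)) <
        ENNReal.ofReal |P.risk k (P.model θ) - P.empRisk S (P.model θ)|}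
      ≤ ENNReal.ofReal (s.card * (2 * Real.exp (-(m * ε ^ 2 / (2 * (3 * (M * R)) ^ 2))))) := by
  have := P.prob k
  have hset : {S : Fin m → X × Y | ∃ θ, ENNReal.ofReal (ε + 2 * (M * r)) <
        ENNReal.ofReal |P.risk k (P.model θ) - P.empRisk S (P.model θ)|} ⊆
      ⋃ θ ∈ s, {S | ε ≤ |∫ z, P.loss (P.model θ z.1) z.2 ∂(P.D k) -
        (1 / (m : ℝ)) * ∑ i, P.loss (P.model θ (S i).1) (S i).2|} := by
    rintro S ⟨θ, hθ⟩
    obtain ⟨θ', hθ', hd⟩ := hs θ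
    simp only [Set.mem_iUnion]
    refine ⟨θ', hθ', ?_⟩
    change ε ≤ |P.risk k (P.model θ') - P.empRisk S (P.model θ')|
    have h0 := lt_of_not_ge fun hle => (ENNReal.ofReal_le_ofReal hle).not_gt hθ
    have hMd := mul_le_mul_of_nonneg_left hd hM
    have h1 := (hb.abs_risk_sub_le (P.model_mem θ) (P.model_mem θ') k).trans hMd
    have h2 := (h.abs_empRisk_sub_le hm S θ θ').trans hMd
    rw [abs_le] at h1 h2
    have h3 : |P.risk k (P.model θ) - P.empRisk S (P.model θ)| ≤
        |P.risk k (P.model θ') - P.empRisk S (P.model θ')| + 2 * (M * r) := by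
      rw [abs_le]
      have := neg_abs_le (P.risk k (P.model θ') - P.empRisk S (P.model θ'))
      have := le_abs_self (P.risk k (P.model θ') - P.empRisk S (P.model θ'))
      constructor <;> linarith
    linarith
  calc _ ≤ _ := measure_mono hset
    _ ≤ _ := measure_biUnion_finset_le _ _
    _ ≤ ∑ _θ ∈ s, ENNReal.ofReal (2 * Real.exp (-(m * ε ^ 2 / (2 * (3 * (M * R)) ^ 2)))) :=
      Finset.sum_le_sum fun θ _ => measure_abs_integral_sub_mean_ge_le (P.D k)
        (P.integrable _ (P.model_mem θ) k).aestronglyMeasurable.aemeasurable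
        (fun z => h.abs_loss_le hb hM θ z.1 z.2) hm hε
    _ = _ := by
      rw [ENNReal.ofReal_mul (Nat.cast_nonneg _)]
      simp

/-- The rate constant of the uniform convergence level. -/
def rateConst (K : ℝ) : ℝ := 3 * (18 + 8 * Real.log (max |K| 1)) + 4

lemma rateConst_pos (K : ℝ) : 0 < rateConst K := by
  have := Real.log_nonneg (le_max_right |K| 1)
  unfold rateConst
  positivity

/-- For `M = 0` the loss vanishes on the class. The case is separate because the Hoeffding exponent
would divide by zero. -/
lemma zeta_le_of_eq_zero {P : CLProblem t X Y V Θ} {R : ℝ} (hb : P.BoundedLipschitz R 0)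
    (h : P.PointwiseBoundedLipschitz R 0) (n : ℕ) (δ : ℝ) : P.zeta n δ = 0 := by
  refine le_antisymm (sInf_le fun k m _ => ?_) bot_le
  have hz : ∀ θ x y, P.loss (P.model θ x) y = 0 := fun θ x y => by
    simpa using h.abs_loss_le hb le_rfl θ x y
  simp [risk, empRisk, hz]

lemma zeta_le_rate {P : CLProblem t X Y V Θ} {K R M : ℝ} (hR : 0 < R) (hM : 0 ≤ M)
    (hb : P.BoundedLipschitz R M) {d : ℕ} (hd : 1 ≤ d) (hdim : P.HasMetricDim K R d)
    (h : P.PointwiseBoundedLipschitz R M) {n : ℕ} {δ : ℝ} (hn : 2 ≤ n) (hδ : 0 < δ)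
    (hδ2 : δ ≤ 1 / 2) :
    P.zeta n δ ≤ ENNReal.ofReal (rateConst K *
      (R * M * Real.sqrt (d * Real.log n * Real.log (d / δ)) / Real.sqrt n)) := by
  rcases hM.eq_or_lt with rfl | hM0
  · rw [zeta_le_of_eq_zero hb h]; exact bot_le
  refine sInf_le fun k m hm => ?_
  have hn0 : (0 : ℝ) < n := by exact_mod_cast (by omega : 0 < n)
  have hmn : (n : ℝ) ≤ m := by exact_mod_cast hm
  have hm0 : 0 < m := by omega
  have hm' : (0 : ℝ) < m := by exact_mod_cast hm0
  have hsm : 1 ≤ Real.sqrt m := by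
    rw [Real.one_le_sqrt]; exact_mod_cast hm0
  -- Truncating at `1` makes `log K'` nonnegative and allows any real `K`.
  set K' := max |K| 1 with hK'
  have hK1 : 1 ≤ K' := le_max_right _ _
  have hKK : |K| ≤ K' := le_max_left _ _
  have hK0 : 0 < K' := by linarith
  set a := Real.log K' with ha'
  have ha : 0 ≤ a := Real.log_nonneg hK1
  obtain ⟨hT, hA1⟩ := log_net_le hn hm hd ha hδ hδ2
  set A := (d : ℝ) * Real.log n * Real.log (d / δ) with hA
  have hA0 : 0 ≤ A := by linarith
  obtain ⟨s, hcard, hs⟩ := hdim (R / Real.sqrt m) (by positivity)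
    (div_le_self hR.le hsm)
  have hcard' : (s.card : ℝ) ≤ (K' * Real.sqrt m) ^ d := by
    refine (hcard.trans (le_abs_self _)).trans ?_
    rw [abs_pow]
    have : K * R / (R / Real.sqrt m) = K * Real.sqrt m := by field_simp
    rw [this, abs_mul, abs_of_nonneg (Real.sqrt_nonneg _)]
    gcongr
  -- Twice the constant of `log_net_le`, so that `C₁ ^ 2 / 2` dominates that constant. Measuring the
  -- deviation in units of the loss bound `3 M R` makes the Hoeffding exponent simply `m q ^ 2 / 2`.
  set C₁ := 18 + 8 * a with hC₁
  set q := C₁ * (Real.sqrt A / Real.sqrt n) with hq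
  have hq0 : 0 ≤ q := by positivity
  have hq2 : q ^ 2 = C₁ ^ 2 * (A / n) := by
    rw [hq, mul_pow, div_pow, Real.sq_sqrt hA0, Real.sq_sqrt hn0.le]
  have hdev := measure_exists_deviation_le hb h hM s hs k hm0
    (ε := 3 * (M * R) * q) (by positivity)
  refine (measure_mono ?_).trans (hdev.trans (ENNReal.ofReal_le_ofReal ?_))
  · rintro S ⟨θ, hθ⟩
    refine ⟨θ, (ENNReal.ofReal_le_ofReal ?_).trans_lt hθ⟩
    -- The discretization error `2 M R / √m` is thus of the order of the rate; it accounts for the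
    -- `+ 4` in `rateConst`.
    have h1 : 1 / Real.sqrt m ≤ 2 * (Real.sqrt A / Real.sqrt n) := by
      have h2 : (1 : ℝ) ≤ 2 * Real.sqrt A := by
        have : Real.sqrt (1 / 4) ≤ Real.sqrt A := Real.sqrt_le_sqrt (by linarith)
        rw [show (1 / 4 : ℝ) = (1 / 2) ^ 2 by norm_num, Real.sqrt_sq (by norm_num)] at this
        linarith
      rw [← mul_div_assoc]
      exact div_le_div₀ (by positivity) h2 (Real.sqrt_pos.2 hn0) (Real.sqrt_le_sqrt hmn)
    have h3 := mul_le_mul_of_nonneg_left h1 (show 0 ≤ 2 * (M * R) by positivity)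
    have h4 : 2 * (M * (R / Real.sqrt m)) = 2 * (M * R) * (1 / Real.sqrt m) := by ring
    have h5 : rateConst K * (R * M * Real.sqrt A / Real.sqrt n)
        = 3 * (M * R) * q + 2 * (M * R) * (2 * (Real.sqrt A / Real.sqrt n)) := by
      rw [hq, hC₁, ha', hK', rateConst]; ring
    linarith
  · have hexp : (m : ℝ) * (3 * (M * R) * q) ^ 2 / (2 * (3 * (M * R)) ^ 2) = m * q ^ 2 / 2 := by
      field_simp
    have hE : Real.log 2 + d * a + d * (Real.log m / 2) + Real.log (1 / δ) ≤ m * q ^ 2 / 2 := by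
      refine hT.trans ?_
      rw [hq2]
      have h1 : (9 + 4 * a) ≤ C₁ ^ 2 / 2 := by nlinarith
      calc _ ≤ C₁ ^ 2 / 2 * (m / n * A) := by gcongr
        _ = _ := by ring
    have hnet : (K' * Real.sqrt m) ^ d = Real.exp (d * a + d * (Real.log m / 2)) := by
      rw [← mul_add, ← Real.log_sqrt hm'.le, ha', ← Real.log_mul hK0.ne' (by positivity),
        Real.exp_nat_mul, Real.exp_log (by positivity)]
    rw [hexp]
    calc (s.card : ℝ) * (2 * Real.exp (-(m * q ^ 2 / 2)))
        ≤ Real.exp (d * a + d * (Real.log m / 2)) * (Real.exp (Real.log 2) *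
          Real.exp (-(Real.log 2 + d * a + d * (Real.log m / 2) + Real.log (1 / δ)))) := by
          rw [← hnet, Real.exp_log (by norm_num : (0 : ℝ) < 2)]
          gcongr
      _ = Real.exp (Real.log δ) := by
          rw [← Real.exp_add, ← Real.exp_add, one_div, Real.log_inv]
          congr 1
          ring
      _ = δ := Real.exp_log hδ

end CLProblem

end

theorem theorem2 (K : ℝ) : ∃ C : ℝ, 0 < C ∧
    ∀ (t : ℕ) [NeZero t] (X Y V Θ Ω : Type*) [MeasurableSpace X] [MeasurableSpace Y]
      [NormedAddCommGroup V] [NormedSpace ℝ V] [MeasurableSpace Ω]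
      (P : CLProblem t X Y V Θ) (R M ν : ℝ),
      0 < R → 0 ≤ M → 0 < ν →
      P.ConstraintQualification → P.NearUniversal ν → P.BoundedLipschitz R M →
      -- the bound on the dual variables
      (∀ (μ : Measure Ω) [IsProbabilityMeasure μ] (n : Fin t → ℕ)
        (Z : ∀ k, Fin (n k) → Ω → X × Y) (δ : ℝ)
        (lamU lamP : EuclideanSpace ℝ (Fin t)),
        (∀ k, 0 < n k) → (∀ k i, HasLaw (Z k i) (P.D k) μ) → (∀ k, iIndepFun (Z k) μ) →
        0 < δ → δ < 1 →
        IsDualOptimal P.dualU lamU → IsDualOptimal P.dualP lamP →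
        μ {ω | ¬ ∀ (lamHat : EuclideanSpace ℝ (Fin t)) (c : ℝ),
            IsDualOptimal (P.empDualP (fun k i => Z k i ω)) lamHat →
            0 < c → StrongConcaveOn (segment ℝ lamU lamHat) c P.dualU →
            ENNReal.ofReal (‖lamHat - lamU‖ ^ 2) ≤
              ENNReal.ofReal (2 / c) *
                (ENNReal.ofReal (M * ν * (1 + norm1 lamHat)) +
                  6 * P.zeta (⨅ k, n k) δ *
                    ENNReal.ofReal (1 + max (norm1 lamP) (norm1 lamHat)))}
          ≤ ENNReal.ofReal (t * δ)) ∧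
      -- the rate of the uniform convergence level
      (∀ d : ℕ, 1 ≤ d → P.HasMetricDim K R d → P.PointwiseBoundedLipschitz R M →
        ∀ (n : ℕ) (δ : ℝ), 2 ≤ n → 0 < δ → δ ≤ 1 / 2 →
          P.zeta n δ ≤ ENNReal.ofReal
            (C * (R * M * Real.sqrt (d * Real.log n * Real.log (d / δ)) / Real.sqrt n))) := by
  refine ⟨CLProblem.rateConst K, CLProblem.rateConst_pos K, ?_⟩
  intro t _ X Y V Θ Ω _ _ _ _ _ P R M ν hR hM hν hCQ hNU hBL
  -- Near-universality at a strictly feasible predictor yields a parameter, so the infima over `Θ`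
  -- are not over an empty set.
  obtain ⟨f₀, hf₀, -⟩ := hCQ.2.2
  have : Nonempty Θ := ⟨(hNU f₀ hf₀).choose⟩
  refine ⟨?_, ?_⟩
  · intro μ _ n Z δ lamU lamP _ hlaw hind _ _ hU hP
    exact CLProblem.measure_dual_bound_fails_le hBL hM hν.le hNU μ δ hlaw hind hU hP
  · intro d hd hdim hPL n δ hn hδ hδ2
    exact CLProblem.zeta_le_rate hR hM hBL hd hdim hPL hn hδ hδ2
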